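/- **Setting.** Let $L_1,L_2$ be positive integers, $M_1,M_2\in\mathbb Z$, and write $w_{\ell,j}=2^{L_\ell j+M_\ell}$ for $\ell\in\{1,2\}$, $j\in\mathbb Z$. Put $\omega'_{\ell,j}=\{\xi\in\mathbb R: w_{\ell,j}/2\le|\xi|\le 2w_{\ell,j}\}$ for $\ell\in\{1,2\}$. If $w_{2,j}<w_{1,j}/8$, let $\omega'_{3,j}=\{w_{1,j}/8\le|\xi|\le 19w_{1,j}/8\}$ and $E_j=\{w_{1,j}/4\le|\xi|\le 9w_{1,j}/4\}$; if $w_{1,j}<w_{2,j}/8$, define $\omega'_{3,j}$ and $E_j$ in the same way with $w_{2,j}$ in place of $w_{1,j}$; in the remaining case let $\omega'_{3,j}=\{|\xi|\le 18\max(w_{1,j},w_{2,j})\}$ and $E_j=\{|\xi|\le 17\max(w_{1,j},w_{2,j})\}$. Let $\widehat f(\xi)=\int f(x)e^{-2\pi i x\xi}\,dx$. Let $\Phi_1$ be a Schwartz function with $\widehat\Phi_1$ supported in $[1/2,2]$. For $\ell\in\{1,2\}$ let $\Phi_{\ell,j,0}$ be given by $\widehat\Phi_{\ell,j,0}(\xi)=\widehat\Phi_1(\xi/w_{\ell,j})$.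 Let $\Phi_{3,j,0}$ be Schwartz functions whose Fourier transforms are bump functions adapted to $\omega'_{3,j}$, that is, supported in $\omega'_{3,j}$ with $|D^\alpha\widehat\Phi_{3,j,0}|\le K_\alpha|\omega'_{3,j}|^{-\alpha}$ for all $\alpha\ge0$ and $j\in\mathbb Z$, and which satisfy $\widehat\Phi_{3,j,0}=1$ on $E_j$. For $\ell\in\{1,2,3\}$ put $f_{\ell,j,0}=f_\ell*\Phi_{\ell,j,0}$. Let $\psi\ge0$ be a Schwartz function with $\widehat\psi$ supported in $[-1/100,1/100]$ and $\widehat\psi(0)=1$, and let $\psi_k(x)=2^k\psi(2^kx)$. Let $k_{j\ell}$ be integers with $|\omega'_{\ell,j}|\sim2^{k_{j\ell}}$ (that is, $A^{-1}2^{k_{j\ell}}\le|\omega'_{\ell,j}|\le A2^{k_{j\ell}}$ for a fixed constant $A$), let $k_j=\min_\ell k_{j\ell}$, $I_{k,n}=[2^{-k}n,2^{-k}(n+1)]$, and $\mathbf 1^*_{j,n}=\mathbf 1_{I_{k_j,n}}*\psi_{k_j}$. For an integer $m\ge0$ let $m_{j\ell}=2^{m-jL_\ell-M_\ell}$ for $\ell\in\{1,2\}$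 and $m_{j3}=0$, and $$F_{\ell,j,n,m}(x)=\big(\mathbf 1^*_{j,n}f_{\ell,j,0}\big)(x+m_{j\ell}).$$ Fix an integer $0\le\gamma<2^{100}$ and let $\mathbf S\subset\{j\in\mathbb Z:j\equiv\gamma\bmod 2^{100}\}\times\mathbb Z$. For $\mathbf S'\subset\mathbf S$ define $$\Lambda_{\mathbf S',m}(f_1,f_2,f_3)=\int_{\mathbb R}\sum_{j\in\mathbb Z}\prod_{\ell=1}^3\ \sum_{n:(j,n)\in\mathbf S'}F_{\ell,j,n,m}(x)\,dx,$$ and let $$\mathbf S^{(1)}=\big\{(j,n)\in\mathbf S:\ |\omega'_{2,j}|\le|\omega'_{1,j}|/10\ \text{ or }\ |\omega'_{1,j}|\le|\omega'_{2,j}|/10\big\}.$$ **Proposition.** Let $p_1,p_2>2$ and $1<r<2$ with $1/p_1+1/p_2=1/r$, and let $1/r+1/r'=1$. Let $f_1\in L^{p_1}(\mathbb R)$, $f_2\in L^{p_2}(\mathbb R)$ and $f_3\in L^{r'}(\mathbb R)$ be complex-valued. Then $\Lambda_{\mathbf S^{(1)},m}(f_1,f_2,f_3)$ is well defined (the sums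 over $n$ converge absolutely at every point, the sum over $j$ converges absolutely almost everywhere, and its value is an integrable function of $x$), and $$\big|\Lambda_{\mathbf S^{(1)},m}(f_1,f_2,f_3)\big|\le C\,\|f_1\|_{p_1}\|f_2\|_{p_2}\|f_3\|_{r'},$$ where $C$ depends only on $p_1,p_2,r,\Phi_1,\psi$, the constants $(K_\alpha)_{\alpha\ge0}$ and $A$; in particular $C$ is independent of $m$, $f_1,f_2,f_3$, and also of $L_1,L_2,M_1,M_2,\gamma,\mathbf S$. -/

import Mathlib

open MeasureTheory
open scoped FourierTransform SchwartzMap ContDiff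

noncomputable section

namespace Paraproduct

/-- The width parameters `L₁, L₂` (positive integers) and the overlap parameters `M₁, M₂`
(integers) of a paraproduct. -/
structure Params where
  L₁ : ℕ
  L₂ : ℕ
  M₁ : ℤ
  M₂ : ℤ
  L₁_pos : 0 < L₁
  L₂_pos : 0 < L₂

/-- `2 ^ (L₁ j + M₁)` -/
def w₁ (P : Params) (j : ℤ) : ℝ := (2 : ℝ) ^ ((P.L₁ : ℤ) * j + P.M₁)

/-- `2 ^ (L₂ j + M₂)` -/
def w₂ (P : Params) (j : ℤ) : ℝ := (2 : ℝ) ^ ((P.L₂ : ℤ) * j + P.M₂)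

/-- The set of frequencies `ξ` with `a ≤ |ξ| ≤ b`. -/
def annulus (a b : ℝ) : Set ℝ := {ξ | a ≤ |ξ| ∧ |ξ| ≤ b}

/-- The frequency window of the third function. -/
def omega₃ (P : Params) (j : ℤ) : Set ℝ :=
  if w₂ P j < w₁ P j / 8 then annulus (w₁ P j / 8) (19 * w₁ P j / 8)
  else if w₁ P j < w₂ P j / 8 then annulus (w₂ P j / 8) (19 * w₂ P j / 8)
  else {ξ | |ξ| ≤ 18 * max (w₁ P j) (w₂ P j)}

/-- The set on which the third frequency bump is required to be equal to one. -/
def plateau₃ (P : Params) (j : ℤ) : Set ℝ :=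
  if w₂ P j < w₁ P j / 8 then annulus (w₁ P j / 4) (9 * w₁ P j / 4)
  else if w₁ P j < w₂ P j / 8 then annulus (w₂ P j / 4) (9 * w₂ P j / 4)
  else {ξ | |ξ| ≤ 17 * max (w₁ P j) (w₂ P j)}

/-- The frequency windows; the indices `0, 1, 2 : Fin 3` stand for the three functions. -/
def omega (P : Params) : Fin 3 → ℤ → Set ℝ :=
  ![fun j => annulus (w₁ P j / 2) (2 * w₁ P j),
    fun j => annulus (w₂ P j / 2) (2 * w₂ P j),
    omega₃ P]

/-- `φ` is a bump function adapted to `W`, with constants `K α` : it is smooth, supported in `W`,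
and its derivative of order `α` is bounded by `K α * |W| ^ (-α)`. -/
structure IsAdaptedBump (K : ℕ → ℝ) (W : Set ℝ) (φ : ℝ → ℂ) : Prop where
  smooth : ContDiff ℝ ∞ φ
  supp : tsupport φ ⊆ W
  bound : ∀ (α : ℕ) (ξ : ℝ), ‖iteratedDeriv α φ ξ‖ ≤ K α * ((volume.real W) ^ α)⁻¹

/-- `Φ₃` is an admissible choice of the third family of kernels. -/
structure IsThirdFamily (K : ℕ → ℝ) (P : Params) (Φ₃ : ℤ → 𝓢(ℝ, ℂ)) : Prop where
  adapted : ∀ j, IsAdaptedBump K (omega P 2 j) (𝓕 (Φ₃ j : ℝ → ℂ))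
  eq_one : ∀ j, ∀ ξ ∈ plateau₃ P j, 𝓕 (Φ₃ j : ℝ → ℂ) ξ = 1

/-- The dilate of `Φ` whose Fourier transform is `ξ ↦ 𝓕 Φ (ξ / w)`, for `w > 0`; see
`fourier_dilate`. -/
def dilate (Φ : 𝓢(ℝ, ℂ)) (w : ℝ) (x : ℝ) : ℂ := w * Φ (w * x)

theorem fourier_dilate (Φ : 𝓢(ℝ, ℂ)) {w : ℝ} (hw : 0 < w) (ξ : ℝ) :
    𝓕 (dilate Φ w) ξ = 𝓕 (Φ : ℝ → ℂ) (ξ / w) := by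
  rw [Real.fourier_eq', Real.fourier_eq']
  have h := Measure.integral_comp_mul_left
    (fun y : ℝ => Complex.exp (((-2 * Real.pi * inner ℝ y (ξ / w) : ℝ) : ℂ) * Complex.I) • Φ y) w
  rw [abs_of_pos (inv_pos.2 hw)] at h
  have h2 : ∀ z : ℂ, z = (w : ℝ) • ((w⁻¹ : ℝ) • z) := fun z => by
    rw [smul_smul, mul_inv_cancel₀ hw.ne', one_smul]
  rw [h2 (∫ v : ℝ, _ • Φ v), ← h, ← integral_smul]
  congr 1
  ext x
  have : inner ℝ (w * x) (ξ / w) = inner ℝ x ξ := by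
    simp only [RCLike.inner_apply, conj_trivial]
    field_simp
  rw [this]
  simp only [dilate, smul_eq_mul, Complex.real_smul]
  ring

/-- The kernels of frequency localization (without modulation) of the three functions; both of the
first two come from the same `Φ`. -/
def kernel (P : Params) (Φ : 𝓢(ℝ, ℂ)) (Φ₃ : ℤ → 𝓢(ℝ, ℂ)) : Fin 3 → ℤ → ℝ → ℂ :=
  ![fun j => dilate Φ (w₁ P j), fun j => dilate Φ (w₂ P j), fun j => Φ₃ j]

/-- The frequency localized functions `f_{ℓ,j,0} = f_ℓ * Φ_{ℓ,j,0}`. -/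
def localized (P : Params) (Φ : 𝓢(ℝ, ℂ)) (Φ₃ : ℤ → 𝓢(ℝ, ℂ)) (f : Fin 3 → ℝ → ℂ)
    (ℓ : Fin 3) (j : ℤ) : ℝ → ℂ :=
  convolution (f ℓ) (kernel P Φ Φ₃ ℓ j) (ContinuousLinearMap.mul ℝ ℂ) volume

/-- The amount of translation: `2 ^ (m - j L_ℓ - M_ℓ)` for the first two functions, and `0` for the
third. -/
def shift (P : Params) (m : ℕ) : Fin 3 → ℤ → ℝ :=
  ![fun j => (2 : ℝ) ^ ((m : ℤ) - j * P.L₁ - P.M₁),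
    fun j => (2 : ℝ) ^ ((m : ℤ) - j * P.L₂ - P.M₂),
    fun _ => 0]

/-- The integers `k ℓ j` satisfy `|ω_{ℓ,j}| ∼ 2 ^ (k ℓ j)`, with implied constant `A`. -/
def IsScale (A : ℝ) (P : Params) (k : Fin 3 → ℤ → ℤ) : Prop :=
  ∀ ℓ j, (2 : ℝ) ^ k ℓ j ≤ A * volume.real (omega P ℓ j) ∧
    volume.real (omega P ℓ j) ≤ A * (2 : ℝ) ^ k ℓ j

/-- The smallest of the three scales. -/
def minScale (k : Fin 3 → ℤ → ℤ) (j : ℤ) : ℤ := min (k 0 j) (min (k 1 j) (k 2 j))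

/-- `ψ` is nonnegative, its Fourier transform is supported in `[-1/100, 1/100]` and is equal to one
at the origin. -/
structure IsCutoff (ψ : 𝓢(ℝ, ℝ)) : Prop where
  nonneg : ∀ x, 0 ≤ ψ x
  supp : tsupport (𝓕 (fun x => (ψ x : ℂ))) ⊆ Set.Icc (-(1 / 100)) (1 / 100)
  one : 𝓕 (fun x => (ψ x : ℂ)) 0 = 1

/-- The interval `I_{k,n} = [2 ^ (-k) n, 2 ^ (-k) (n + 1)]`. -/
def dyadic (k n : ℤ) : Set ℝ := Set.Icc ((2 : ℝ) ^ (-k) * n) ((2 : ℝ) ^ (-k) * (n + 1))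

/-- The smooth approximation of the indicator function of `I_{k,n}`: the convolution of this
indicator function with `2 ^ k ψ (2 ^ k ·)`. -/
def smoothInd (ψ : 𝓢(ℝ, ℝ)) (k n : ℤ) : ℝ → ℝ :=
  convolution ((dyadic k n).indicator fun _ => (1 : ℝ))
    (fun x => (2 : ℝ) ^ k * ψ ((2 : ℝ) ^ k * x)) (ContinuousLinearMap.mul ℝ ℝ) volume

/-- `F_{ℓ,j,n,m}`: the function `1*_{j,n} f_{ℓ,j,0}`, evaluated at the translated point. -/
def piece (P : Params) (Φ : 𝓢(ℝ, ℂ)) (Φ₃ : ℤ → 𝓢(ℝ, ℂ)) (ψ : 𝓢(ℝ, ℝ)) (k : Fin 3 → ℤ → ℤ)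
    (m : ℕ) (f : Fin 3 → ℝ → ℂ) (ℓ : Fin 3) (j n : ℤ) (x : ℝ) : ℂ :=
  (smoothInd ψ (minScale k j) n (x + shift P m ℓ j) : ℂ) *
    localized P Φ Φ₃ f ℓ j (x + shift P m ℓ j)

/-- The product over `ℓ` of the sums of `F_{ℓ,j,n,m}` over all `n` with `(j, n) ∈ S`. -/
def term (P : Params) (Φ : 𝓢(ℝ, ℂ)) (Φ₃ : ℤ → 𝓢(ℝ, ℂ)) (ψ : 𝓢(ℝ, ℝ)) (k : Fin 3 → ℤ → ℤ)
    (m : ℕ) (S : Set (ℤ × ℤ)) (f : Fin 3 → ℝ → ℂ) (j : ℤ) (x : ℝ) : ℂ :=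
  ∏ ℓ : Fin 3, ∑' n : {n : ℤ // (j, n) ∈ S}, piece P Φ Φ₃ ψ k m f ℓ j n x

/-- The trilinear form `Λ_{S,m}`. -/
def form (P : Params) (Φ : 𝓢(ℝ, ℂ)) (Φ₃ : ℤ → 𝓢(ℝ, ℂ)) (ψ : 𝓢(ℝ, ℝ)) (k : Fin 3 → ℤ → ℤ)
    (m : ℕ) (S : Set (ℤ × ℤ)) (f : Fin 3 → ℝ → ℂ) : ℂ :=
  ∫ x : ℝ, ∑' j : ℤ, term P Φ Φ₃ ψ k m S f j x

/-- `S^{(1)}`: the part of `S` where one of the first two windows is at least ten times as long as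
the other one. -/
def goodPart (P : Params) (S : Set (ℤ × ℤ)) : Set (ℤ × ℤ) :=
  {s ∈ S | volume.real (omega P 1 s.1) ≤ volume.real (omega P 0 s.1) / 10 ∨
    volume.real (omega P 0 s.1) ≤ volume.real (omega P 1 s.1) / 10}

end Paraproduct

end

namespace Paraproduct

open Filter Topology
open scoped ENNReal

/-! When one of the first two windows is ten times longer than the other, the third window is also
an annulus away from the origin. So for each of the three functions the frequency windows are
lacunary in `j`, and every frequency meets boundedly many of them. Bounded overlap and Plancherel
bound the map from `f` to the family `f * φ j` from `L²` to `L²(ℓ²)`; uniform `L¹` bounds on the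
kernels bound it from `L^∞` to `L^∞(ℓ^∞)`. Interpolation gives `L^p → L^p(ℓ^p)` for every `p > 2`
(`tsum_lintegral_convolution_rpow_le`, specialized in `tsum_lintegral_localized_rpow_le`). The
exponents `p₁, p₂, r'` all exceed 2 and their reciprocals sum to 1, so Hölder's inequality in `x`
and `j` together (`tsum_lintegral_prod_le`) bounds the form. The cutoffs sum to a factor in `[0, 1]`
and are discarded. The translations preserve each `L^p` norm in `x` for fixed `j`, hence the
`L^p(ℓ^p)` norm as well; this is why no dependence on `m` arises. -/

/-! ### The `L²` square function estimate. -/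

theorem eLpNorm_two_sq {α E : Type*} [MeasurableSpace α] [NormedAddCommGroup E] (μ : Measure α)
    (f : α → E) : eLpNorm f 2 μ ^ 2 = ∫⁻ x, ‖f x‖ₑ ^ 2 ∂μ := by
  have := eLpNorm_nnreal_pow_eq_lintegral (f := f) (μ := μ) (p := 2) two_ne_zero
  simpa using this

theorem lintegral_fourier_sq (g : 𝓢(ℝ, ℂ)) :
    ∫⁻ ξ, ‖𝓕 (g : ℝ → ℂ) ξ‖ₑ ^ 2 = ∫⁻ x, ‖g x‖ₑ ^ 2 := by
  have h := congrArg ENNReal.ofReal (SchwartzMap.norm_fourier_toL2_eq g)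
  rw [ofReal_norm, ofReal_norm, Lp.enorm_def, Lp.enorm_def,
    eLpNorm_congr_ae (SchwartzMap.coeFn_toLp (𝓕 g) 2 volume),
    eLpNorm_congr_ae (SchwartzMap.coeFn_toLp g 2 volume)] at h
  rw [← eLpNorm_two_sq, ← eLpNorm_two_sq, ← h]
  rfl

theorem convolution_schwartz_apply (h φ : 𝓢(ℝ, ℂ)) (x : ℝ) :
    convolution h φ (ContinuousLinearMap.mul ℝ ℂ) volume x =
      SchwartzMap.convolution (ContinuousLinearMap.mul ℂ ℂ) h φ x := by
  rw [SchwartzMap.convolution_apply]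
  simp [convolution_def]

/-- By Plancherel the left side is the integral of `|𝓕 h|²` against the sum of the `|𝓕 (φ j)|²`. -/
theorem sum_lintegral_convolution_sq_le_of_schwartz {ι : Type*} (s : Finset ι)
    (φ : ι → 𝓢(ℝ, ℂ)) (B : ℝ≥0∞) (hB : ∀ ξ, ∑ j ∈ s, ‖𝓕 (φ j : ℝ → ℂ) ξ‖ₑ ^ 2 ≤ B)
    (h : 𝓢(ℝ, ℂ)) :
    ∫⁻ x, ∑ j ∈ s, ‖convolution h (φ j) (ContinuousLinearMap.mul ℝ ℂ) volume x‖ₑ ^ 2 ≤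
      B * ∫⁻ x, ‖h x‖ₑ ^ 2 := by
  have hm : ∀ g : 𝓢(ℝ, ℂ), Measurable fun x => ‖g x‖ₑ ^ 2 := fun g =>
    (g.continuous.measurable.enorm).pow_const 2
  simp only [convolution_schwartz_apply]
  rw [lintegral_finsetSum _ fun j _ => hm _]
  simp only [← lintegral_fourier_sq]
  have hm' : ∀ g : 𝓢(ℝ, ℂ), Measurable fun x => ‖𝓕 (g : ℝ → ℂ) x‖ₑ ^ 2 := fun g => hm (𝓕 g)
  rw [← lintegral_finsetSum _ fun j _ => hm' _, ← lintegral_const_mul _ (hm' h)]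
  refine lintegral_mono fun ξ => ?_
  have : ∀ j, 𝓕 (SchwartzMap.convolution (ContinuousLinearMap.mul ℂ ℂ) h (φ j) : ℝ → ℂ) ξ =
      𝓕 (h : ℝ → ℂ) ξ * 𝓕 (φ j : ℝ → ℂ) ξ := fun j => by
    rw [← SchwartzMap.fourier_coe, SchwartzMap.fourier_convolution]
    rfl
  simp only [this, enorm_mul, mul_pow]
  rw [← Finset.mul_sum, mul_comm]
  gcongr
  exact hB ξ

theorem convolutionExistsAt_of_memLp_two {h : ℝ → ℂ} (hh : MemLp h 2) (φ : 𝓢(ℝ, ℂ)) (x : ℝ) :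
    ConvolutionExistsAt h φ x (ContinuousLinearMap.mul ℝ ℂ) volume := by
  have hφ : MemLp (fun t => φ (x - t)) 2 :=
    (φ.memLp 2).comp_measurePreserving (Measure.measurePreserving_sub_left volume x)
  exact hh.integrable_mul hφ

/-- Cauchy–Schwarz. It turns `L²` convergence of Schwartz approximants into pointwise convergence of
their convolutions. -/
theorem enorm_convolution_le {h : ℝ → ℂ} (hh : MemLp h 2) (φ : 𝓢(ℝ, ℂ)) (x : ℝ) :
    ‖convolution h φ (ContinuousLinearMap.mul ℝ ℂ) volume x‖ₑ ≤ eLpNorm h 2 * eLpNorm (φ : ℝ → ℂ) 2 volume := by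
  have mp := Measure.measurePreserving_sub_left volume x
  have hφ : MemLp (fun t => φ (x - t)) 2 := (φ.memLp 2).comp_measurePreserving mp
  have hn : eLpNorm (fun t => φ (x - t)) 2 = eLpNorm (φ : ℝ → ℂ) 2 volume :=
    eLpNorm_comp_measurePreserving (φ.memLp (μ := volume) 2).1 mp
  have key : eLpNorm (h • fun t => φ (x - t)) 1 volume ≤
      eLpNorm h 2 volume * eLpNorm (fun t => φ (x - t)) 2 volume :=
    eLpNorm_smul_le_mul_eLpNorm hφ.1 hh.1
  rw [hn, eLpNorm_one_eq_lintegral_enorm] at key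
  exact (enorm_integral_le_lintegral_enorm _).trans key

/-- The square function bound on `L²`, for kernels whose Fourier transforms overlap boundedly. -/
theorem sum_lintegral_convolution_sq_le {ι : Type*} (s : Finset ι)
    (φ : ι → 𝓢(ℝ, ℂ)) {B : ℝ≥0∞} (hBt : B ≠ ⊤)
    (hB : ∀ ξ, ∑ j ∈ s, ‖𝓕 (φ j : ℝ → ℂ) ξ‖ₑ ^ 2 ≤ B)
    {h : ℝ → ℂ} (hh : MemLp h 2) :
    ∫⁻ x, ∑ j ∈ s, ‖convolution h (φ j) (ContinuousLinearMap.mul ℝ ℂ) volume x‖ₑ ^ 2 ≤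
      B * ∫⁻ x, ‖h x‖ₑ ^ 2 := by
  have key : ∀ n : ℕ, ∃ g : 𝓢(ℝ, ℂ), eLpNorm (h - ⇑g) 2 ≤ ENNReal.ofReal (1 / ((n : ℝ) + 1)) := by
    intro n
    obtain ⟨g, h1, h2, h3⟩ := MemLp.exist_eLpNorm_sub_le (by simp) (by norm_num) hh
      (show (0 : ℝ) < 1 / ((n : ℝ) + 1) by positivity)
    exact ⟨h1.toSchwartzMap h2, h3⟩
  choose g hg using key
  have hlim : Tendsto (fun n => eLpNorm (h - ⇑(g n)) 2) atTop (𝓝 0) := by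
    refine tendsto_of_tendsto_of_tendsto_of_le_of_le tendsto_const_nhds ?_ (fun _ => zero_le) hg
    rw [← ENNReal.ofReal_zero]
    exact ENNReal.tendsto_ofReal tendsto_one_div_add_atTop_nhds_zero_nat
  have hgm : ∀ n, MemLp (g n : ℝ → ℂ) 2 := fun n => (g n).memLp 2
  have hptw : ∀ j x, Tendsto
      (fun n => convolution (g n) (φ j) (ContinuousLinearMap.mul ℝ ℂ) volume x) atTop
      (𝓝 (convolution h (φ j) (ContinuousLinearMap.mul ℝ ℂ) volume x)) := by
    intro j x
    rw [tendsto_iff_edist_tendsto_0]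
    have h0 : Tendsto (fun n => eLpNorm (h - ⇑(g n)) 2 * eLpNorm (φ j : ℝ → ℂ) 2 volume) atTop (𝓝 0) := by
      have := ENNReal.Tendsto.mul_const (b := eLpNorm (φ j : ℝ → ℂ) 2 volume) hlim
        (Or.inr ((φ j).memLp (μ := volume) 2).eLpNorm_ne_top)
      simpa using this
    refine tendsto_of_tendsto_of_tendsto_of_le_of_le tendsto_const_nhds h0 (fun _ => zero_le)
      fun n => ?_
    rw [edist_comm, edist_eq_enorm_sub]
    have hd := enorm_convolution_le (hh.sub (hgm n)) (φ j) x
    have e : convolution (h - ⇑(g n)) (φ j) (ContinuousLinearMap.mul ℝ ℂ) volume x =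
        convolution h (φ j) (ContinuousLinearMap.mul ℝ ℂ) volume x -
        convolution (g n) (φ j) (ContinuousLinearMap.mul ℝ ℂ) volume x := by
      have i1 := convolutionExistsAt_of_memLp_two hh (φ j) x
      have i2 := convolutionExistsAt_of_memLp_two (hgm n) (φ j) x
      rw [convolution_def, convolution_def, convolution_def, ← integral_sub i1 i2]
      simp
    rwa [e] at hd
  have hlim2 : Tendsto (fun n => B * ∫⁻ x, ‖g n x‖ₑ ^ 2) atTop (𝓝 (B * ∫⁻ x, ‖h x‖ₑ ^ 2)) := by
    refine ENNReal.Tendsto.const_mul ?_ (Or.inr hBt)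
    simp only [← eLpNorm_two_sq]
    refine ENNReal.Tendsto.pow ?_
    have hfin := hh.eLpNorm_ne_top
    have up : Tendsto (fun n => eLpNorm h 2 volume + eLpNorm (h - ⇑(g n)) 2) atTop
        (𝓝 (eLpNorm h 2 volume)) := by
      simpa using tendsto_const_nhds.add hlim
    have lo : Tendsto (fun n => eLpNorm h 2 volume - eLpNorm (h - ⇑(g n)) 2) atTop
        (𝓝 (eLpNorm h 2 volume)) := by
      simpa using ENNReal.Tendsto.sub tendsto_const_nhds hlim (Or.inl hfin)
    refine tendsto_of_tendsto_of_tendsto_of_le_of_le lo up (fun n => ?_) fun n => ?_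
    · rw [tsub_le_iff_left]
      calc eLpNorm h 2 volume = eLpNorm ((h - ⇑(g n)) + ⇑(g n)) 2 volume := by simp
        _ ≤ _ := eLpNorm_add_le (hh.sub (hgm n)).1 (hgm n).1 (by norm_num)
    · calc eLpNorm (g n : ℝ → ℂ) 2 volume = eLpNorm (h - (h - ⇑(g n))) 2 volume := by simp
        _ ≤ _ := eLpNorm_sub_le hh.1 (hh.sub (hgm n)).1 (by norm_num)
  -- Fatou's lemma carries the Schwartz estimate to the limit, so pointwise convergence of the
  -- convolutions suffices.
  calc _ = ∫⁻ x, liminf (fun n => ∑ j ∈ s,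
        ‖convolution (g n) (φ j) (ContinuousLinearMap.mul ℝ ℂ) volume x‖ₑ ^ 2) atTop := by
        refine lintegral_congr fun x => (Tendsto.liminf_eq ?_).symm
        refine tendsto_finsetSum _ fun j _ => ENNReal.Tendsto.pow ?_
        exact (continuous_enorm.tendsto _).comp (hptw j x)
    _ ≤ liminf (fun n => ∫⁻ x, ∑ j ∈ s,
        ‖convolution (g n) (φ j) (ContinuousLinearMap.mul ℝ ℂ) volume x‖ₑ ^ 2) atTop := by
        refine lintegral_liminf_le fun n => Finset.measurable_sum _ fun j _ => ?_
        simp only [convolution_schwartz_apply]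
        exact ((SchwartzMap.continuous _).measurable.enorm).pow_const 2
    _ ≤ liminf (fun n => B * ∫⁻ x, ‖g n x‖ₑ ^ 2) atTop :=
        liminf_le_liminf (Eventually.of_forall fun n =>
          sum_lintegral_convolution_sq_le_of_schwartz s φ B hB (g n))
    _ = _ := hlim2.liminf_eq

/-! ### Interpolation between `L²(ℓ²)` and `L^∞(ℓ^∞)`. -/

theorem aestronglyMeasurable_convolution {f : ℝ → ℂ} (hf : AEStronglyMeasurable f) (φ : 𝓢(ℝ, ℂ)) :
    AEStronglyMeasurable (convolution f φ (ContinuousLinearMap.mul ℝ ℂ) volume) :=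
  (hf.convolution_integrand' (μ := volume) (ContinuousLinearMap.mul ℝ ℂ)
    φ.continuous.aestronglyMeasurable).integral_prod_right'

theorem integrable_mul_of_bounded {f : ℝ → ℂ} (hf : AEStronglyMeasurable f) {c : ℝ}
    (hc : ∀ x, ‖f x‖ ≤ c) (φ : 𝓢(ℝ, ℂ)) (x : ℝ) : Integrable fun t => f t * φ (x - t) :=
  ((φ.integrable (μ := volume)).comp_sub_left x).bdd_mul hf (ae_of_all _ hc)

theorem norm_convolution_le_of_bounded {f : ℝ → ℂ} {c : ℝ}
    (hc : ∀ x, ‖f x‖ ≤ c) (φ : 𝓢(ℝ, ℂ)) (x : ℝ) :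
    ‖convolution f φ (ContinuousLinearMap.mul ℝ ℂ) volume x‖ ≤ c * ∫ t, ‖φ t‖ := by
  have hi : Integrable fun t => c * ‖φ (x - t)‖ :=
    ((φ.integrable (μ := volume)).comp_sub_left x).norm.const_mul c
  refine (norm_integral_le_of_norm_le hi (ae_of_all _ fun t => ?_)).trans_eq ?_
  · simpa using mul_le_mul_of_nonneg_right (hc t) (norm_nonneg (φ (x - t)))
  · rw [integral_const_mul, integral_sub_left_eq_self (fun t => ‖φ t‖) volume x]

/-- The weak type bound behind the interpolation: large values of `f * φ j` come from the large
values of `f`. -/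
theorem tsum_measure_convolution_le {ι : Type*} (φ : ι → 𝓢(ℝ, ℂ)) {B : ℝ≥0∞} (hBt : B ≠ ⊤)
    (hB : ∀ (s : Finset ι) ξ, ∑ j ∈ s, ‖𝓕 (φ j : ℝ → ℂ) ξ‖ₑ ^ 2 ≤ B)
    {D : ℝ} (hD : 0 < D) (hφ : ∀ j, ∫ x, ‖φ j x‖ ≤ D) {p : ℝ} (hp : 2 < p) {f : ℝ → ℂ}
    (hfm : Measurable f) (hf : MemLp f (ENNReal.ofReal p)) {t : ℝ} (ht : 0 < t) :
    ∑' j, volume {x | t < ‖convolution f (φ j) (ContinuousLinearMap.mul ℝ ℂ) volume x‖} ≤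
      ENNReal.ofReal (4 / t ^ 2) *
        (B * volume.withDensity (fun x => ‖f x‖ₑ ^ 2) {x | t < 2 * D * ‖f x‖}) := by
  -- Off `S` one has `|f| ≤ t / (2D)`, so this part of `f` contributes at most `t / 2` to each
  -- convolution; a value above `t` forces the part on `S` to contribute at least `t / 2`.
  set S : Set ℝ := {x | t < 2 * D * ‖f x‖} with hS
  have hSm : MeasurableSet S := measurableSet_lt measurable_const (hfm.norm.const_mul _)
  have hp0 : ENNReal.ofReal p ≠ 0 := by simp; linarith
  have hSf : volume S < ⊤ := by
    refine lt_of_le_of_lt (measure_mono fun x hx => ?_)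
      (hf.meas_ge_lt_top'_enorm hp0 ENNReal.ofReal_ne_top
        (ε := ENNReal.ofReal (t / (2 * D))) (by simp; positivity) (by simp))
    rw [Set.mem_ofPred_eq, ← ofReal_norm]
    refine ENNReal.ofReal_le_ofReal ?_
    rw [div_le_iff₀ (by positivity), mul_comm]
    exact (show t < 2 * D * ‖f x‖ from hx).le
  set g : ℝ → ℂ := S.indicator f with hg
  set l : ℝ → ℂ := f - g with hl
  -- `g` is in `L^p` and lives on a set of finite measure, hence is in `L²` as `p > 2`.
  have hgL : MemLp g 2 := by
    rw [hg, memLp_indicator_iff_restrict hSm]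
    have : IsFiniteMeasure (volume.restrict S) := ⟨by simpa using hSf⟩
    refine (hf.restrict S).mono_exponent ?_
    rw [show (2 : ℝ≥0∞) = ENNReal.ofReal 2 by simp]
    exact ENNReal.ofReal_le_ofReal hp.le
  have hlb : ∀ x, ‖l x‖ ≤ t / (2 * D) := by
    intro x
    by_cases hx : x ∈ S
    · simp only [hl, hg, Pi.sub_apply, Set.indicator_of_mem hx, sub_self, norm_zero]
      positivity
    · simp only [hl, hg, Pi.sub_apply, Set.indicator_of_notMem hx, sub_zero]
      rw [le_div_iff₀ (by positivity), mul_comm]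
      exact not_lt.1 hx
  have hlm : Measurable l := hfm.sub (hfm.indicator hSm)
  have hsub : ∀ j x, t < ‖convolution f (φ j) (ContinuousLinearMap.mul ℝ ℂ) volume x‖ →
      ENNReal.ofReal (t / 2) ^ 2 ≤
        ‖convolution g (φ j) (ContinuousLinearMap.mul ℝ ℂ) volume x‖ₑ ^ 2 := by
    intro j x hx
    have e : convolution f (φ j) (ContinuousLinearMap.mul ℝ ℂ) volume x =
        convolution l (φ j) (ContinuousLinearMap.mul ℝ ℂ) volume x +
        convolution g (φ j) (ContinuousLinearMap.mul ℝ ℂ) volume x := by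
      have i1 : ConvolutionExistsAt l (φ j) x (ContinuousLinearMap.mul ℝ ℂ) volume :=
        integrable_mul_of_bounded hlm.aestronglyMeasurable hlb (φ j) x
      have i2 := convolutionExistsAt_of_memLp_two hgL (φ j) x
      rw [convolution_def, convolution_def, convolution_def, ← integral_add i1 i2]
      simp [hl]
    have h1 := norm_convolution_le_of_bounded hlb (φ j) x
    have h2 : t / (2 * D) * ∫ x, ‖φ j x‖ ≤ t / 2 := by
      calc _ ≤ t / (2 * D) * D := by gcongr; exact hφ j
        _ = t / 2 := by field_simp
    rw [← ofReal_norm]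
    gcongr
    have h3 := norm_add_le (convolution l (φ j) (ContinuousLinearMap.mul ℝ ℂ) volume x)
      (convolution g (φ j) (ContinuousLinearMap.mul ℝ ℂ) volume x)
    rw [← e] at h3
    linarith
  have hε : ENNReal.ofReal (t / 2) ^ 2 ≠ 0 := by
    rw [← ENNReal.ofReal_pow (by positivity)]
    simp; positivity
  have hε' : ENNReal.ofReal (t / 2) ^ 2 ≠ ⊤ := by simp
  have hmeas : ∀ j, AEMeasurable
      (fun x => ‖convolution g (φ j) (ContinuousLinearMap.mul ℝ ℂ) volume x‖ₑ ^ 2) := fun j =>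
    (aestronglyMeasurable_convolution hgL.1 (φ j)).enorm.pow_const 2
  have hν : volume.withDensity (fun x => ‖f x‖ₑ ^ 2) S = ∫⁻ x, ‖g x‖ₑ ^ 2 := by
    rw [withDensity_apply' _ S, ← lintegral_indicator hSm]
    refine lintegral_congr fun x => ?_
    by_cases hx : x ∈ S <;> simp [hg, hx]
  rw [hν]
  refine ENNReal.summable.tsum_le_of_sum_le fun s => ?_
  calc _ ≤ ∑ j ∈ s, (∫⁻ x, ‖convolution g (φ j) (ContinuousLinearMap.mul ℝ ℂ) volume x‖ₑ ^ 2) /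
          ENNReal.ofReal (t / 2) ^ 2 :=
        Finset.sum_le_sum fun j _ => (measure_mono (hsub j)).trans
          (meas_ge_le_lintegral_div (hmeas j) hε hε')
    _ = ENNReal.ofReal (4 / t ^ 2) *
          ∫⁻ x, ∑ j ∈ s, ‖convolution g (φ j) (ContinuousLinearMap.mul ℝ ℂ) volume x‖ₑ ^ 2 := by
        rw [lintegral_finsetSum' _ fun j _ => hmeas j, Finset.mul_sum]
        refine Finset.sum_congr rfl fun j _ => ?_
        rw [← ENNReal.ofReal_pow (by positivity), div_eq_mul_inv, mul_comm,
          ← ENNReal.ofReal_inv_of_pos (by positivity)]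
        congr 2
        field_simp
        norm_num
    _ ≤ _ := by
        gcongr
        exact sum_lintegral_convolution_sq_le s φ hBt (hB s) hgL

/-- The constant in `tsum_lintegral_convolution_rpow_le`. -/
noncomputable def interpolationConst (B : ℝ≥0∞) (D p : ℝ) : ℝ≥0∞ :=
  ENNReal.ofReal p * (4 * B * ((ENNReal.ofReal (p - 2))⁻¹ * ENNReal.ofReal ((2 * D) ^ (p - 2))))

theorem interpolationConst_ne_top {B : ℝ≥0∞} (hB : B ≠ ⊤) (D : ℝ) {p : ℝ} (hp : 2 < p) :
    interpolationConst B D p ≠ ⊤ := by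
  have : (ENNReal.ofReal (p - 2))⁻¹ ≠ ⊤ := by simp [hp]
  unfold interpolationConst
  finiteness

/-- Marcinkiewicz interpolation by the layer cake formula. The weak type bound turns `t ^ (p - 1)`
into `t ^ (p - 3)` times the `ν`-measure of `{t < 2D|f|}`, with `ν = |f|² dx`. Integration in `t` is
then the layer cake formula for `ν` with the positive exponent `p - 2`, and `|f|² |f| ^ (p - 2) =
|f| ^ p`. -/
theorem tsum_lintegral_convolution_rpow_le_of_measurable {ι : Type*} [Countable ι]
    (φ : ι → 𝓢(ℝ, ℂ)) {B : ℝ≥0∞} (hBt : B ≠ ⊤)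
    (hB : ∀ (s : Finset ι) ξ, ∑ j ∈ s, ‖𝓕 (φ j : ℝ → ℂ) ξ‖ₑ ^ 2 ≤ B)
    {D : ℝ} (hD : 0 < D) (hφ : ∀ j, ∫ x, ‖φ j x‖ ≤ D) {p : ℝ} (hp : 2 < p) {f : ℝ → ℂ}
    (hfm : Measurable f) (hf : MemLp f (ENNReal.ofReal p)) :
    ∑' j, ∫⁻ x, ‖convolution f (φ j) (ContinuousLinearMap.mul ℝ ℂ) volume x‖ₑ ^ p ≤
      interpolationConst B D p * ∫⁻ x, ‖f x‖ₑ ^ p := by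
  have hp0 : 0 < p := by linarith
  set u : ι → ℝ → ℝ := fun j x =>
    ‖convolution f (φ j) (ContinuousLinearMap.mul ℝ ℂ) volume x‖ with hu
  have hum : ∀ j, AEMeasurable (u j) := fun j =>
    (aestronglyMeasurable_convolution hf.1 (φ j)).norm.aemeasurable
  set ν := volume.withDensity (fun x => ‖f x‖ₑ ^ 2) with hν
  have e1 : ∀ j, ∫⁻ x, ‖convolution f (φ j) (ContinuousLinearMap.mul ℝ ℂ) volume x‖ₑ ^ p =
      ENNReal.ofReal p * ∫⁻ t in Set.Ioi 0, volume {x | t < u j x} *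
        ENNReal.ofReal (t ^ (p - 1)) := fun j => by
    rw [← lintegral_rpow_eq_lintegral_meas_lt_mul volume (ae_of_all _ fun _ => norm_nonneg _)
      (hum j) hp0]
    refine lintegral_congr fun x => ?_
    rw [← ofReal_norm, ENNReal.ofReal_rpow_of_nonneg (norm_nonneg _) hp0.le]
  have e2 : ∫⁻ x, ENNReal.ofReal ((2 * D * ‖f x‖) ^ (p - 2)) ∂ν =
      ENNReal.ofReal (p - 2) * ∫⁻ t in Set.Ioi 0, ν {x | t < 2 * D * ‖f x‖} *
        ENNReal.ofReal (t ^ (p - 2 - 1)) :=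
    lintegral_rpow_eq_lintegral_meas_lt_mul ν (ae_of_all _ fun _ => by positivity)
      (hfm.norm.const_mul _).aemeasurable (by linarith)
  have e3 : ∫⁻ x, ENNReal.ofReal ((2 * D * ‖f x‖) ^ (p - 2)) ∂ν =
      ENNReal.ofReal ((2 * D) ^ (p - 2)) * ∫⁻ x, ‖f x‖ₑ ^ p := by
    rw [hν, lintegral_withDensity_eq_lintegral_mul _ (hfm.enorm.pow_const 2) (by fun_prop),
      ← lintegral_const_mul _ (by fun_prop)]
    refine lintegral_congr fun x => ?_
    simp only [Pi.mul_apply]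
    rw [Real.mul_rpow (by positivity) (norm_nonneg _), ENNReal.ofReal_mul (by positivity),
      ← ENNReal.ofReal_rpow_of_nonneg (norm_nonneg _) (by linarith), ofReal_norm]
    rw [mul_left_comm, ← ENNReal.rpow_two, ← ENNReal.rpow_add_of_nonneg _ _ (by norm_num)
      (by linarith)]
    congr 2
    ring
  have e4 : ∫⁻ t in Set.Ioi 0, ν {x | t < 2 * D * ‖f x‖} * ENNReal.ofReal (t ^ (p - 2 - 1)) =
      (ENNReal.ofReal (p - 2))⁻¹ *
        (ENNReal.ofReal ((2 * D) ^ (p - 2)) * ∫⁻ x, ‖f x‖ₑ ^ p) := by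
    rw [← e3, e2, ← mul_assoc, ENNReal.inv_mul_cancel (by simp; linarith) (by simp), one_mul]
  have hmono : ∀ j, Measurable fun t : ℝ => volume {x | t < u j x} := fun j =>
    (show Antitone fun t : ℝ => volume {x | t < u j x} from fun a b hab =>
      measure_mono fun x hx => lt_of_le_of_lt hab hx).measurable
  have hmono' : Measurable fun t : ℝ => ν {x | t < 2 * D * ‖f x‖} :=
    (show Antitone fun t : ℝ => ν {x | t < 2 * D * ‖f x‖} from fun a b hab =>
      measure_mono fun x hx => lt_of_le_of_lt hab hx).measurable
  simp only [e1]
  rw [ENNReal.tsum_mul_left, ← lintegral_tsum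
      (f := fun j t => volume {x | t < u j x} * ENNReal.ofReal (t ^ (p - 1)))
      fun j => ((hmono j).mul (by fun_prop)).aemeasurable,
    interpolationConst, mul_assoc, mul_assoc, mul_assoc _ _ (∫⁻ x, ‖f x‖ₑ ^ p), ← e4]
  gcongr ENNReal.ofReal p * ?_
  have hmono'' : Measurable fun t : ℝ =>
      ν {x | t < 2 * D * ‖f x‖} * ENNReal.ofReal (t ^ (p - 2 - 1)) := hmono'.mul (by fun_prop)
  rw [← lintegral_const_mul _ hmono'']
  refine setLIntegral_mono' measurableSet_Ioi fun t ht => ?_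
  have ht : 0 < t := ht
  rw [ENNReal.tsum_mul_right]
  calc _ ≤ ENNReal.ofReal (4 / t ^ 2) * (B * ν {x | t < 2 * D * ‖f x‖}) *
        ENNReal.ofReal (t ^ (p - 1)) := by
        gcongr
        exact tsum_measure_convolution_le φ hBt hB hD hφ hp hfm hf ht
    _ = B * ν {x | t < 2 * D * ‖f x‖} *
        (ENNReal.ofReal (4 / t ^ 2) * ENNReal.ofReal (t ^ (p - 1))) := by ring
    _ = B * ν {x | t < 2 * D * ‖f x‖} * (4 * ENNReal.ofReal (t ^ (p - 2 - 1))) := by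
        congr 1
        rw [← ENNReal.ofReal_mul (by positivity),
          show (4 : ℝ≥0∞) = ENNReal.ofReal 4 by simp, ← ENNReal.ofReal_mul (by positivity)]
        congr 1
        rw [show p - 1 = (p - 2 - 1) + 2 by ring, Real.rpow_add ht, Real.rpow_two]
        field_simp
    _ = _ := by ring

/-- For `p > 2`, convolution with boundedly overlapping, uniformly integrable kernels maps `L^p`
to `L^p(ℓ^p)`. -/
theorem tsum_lintegral_convolution_rpow_le {ι : Type*} [Countable ι]
    (φ : ι → 𝓢(ℝ, ℂ)) {B : ℝ≥0∞} (hBt : B ≠ ⊤)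
    (hB : ∀ (s : Finset ι) ξ, ∑ j ∈ s, ‖𝓕 (φ j : ℝ → ℂ) ξ‖ₑ ^ 2 ≤ B)
    {D : ℝ} (hD : 0 < D) (hφ : ∀ j, ∫ x, ‖φ j x‖ ≤ D) {p : ℝ} (hp : 2 < p) {f : ℝ → ℂ}
    (hf : MemLp f (ENNReal.ofReal p)) :
    ∑' j, ∫⁻ x, ‖convolution f (φ j) (ContinuousLinearMap.mul ℝ ℂ) volume x‖ₑ ^ p ≤
      interpolationConst B D p * ∫⁻ x, ‖f x‖ₑ ^ p := by
  -- Convolutions see only the almost everywhere class of `f`, so a measurable representative may be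
  -- used.
  have hae := hf.1.ae_eq_mk
  have h := tsum_lintegral_convolution_rpow_le_of_measurable φ hBt hB hD hφ hp
    hf.1.stronglyMeasurable_mk.measurable (hf.ae_eq hae)
  have hc : ∀ j, convolution (hf.1.mk f) (φ j) (ContinuousLinearMap.mul ℝ ℂ) volume =
      convolution f (φ j) (ContinuousLinearMap.mul ℝ ℂ) volume := fun j => by
    ext x
    refine integral_congr_ae ?_
    filter_upwards [hae] with t ht
    rw [ht]
  have hn : ∫⁻ x, ‖hf.1.mk f x‖ₑ ^ p = ∫⁻ x, ‖f x‖ₑ ^ p := by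
    refine lintegral_congr_ae ?_
    filter_upwards [hae] with t ht
    rw [ht]
  simpa only [hc, hn] using h

/-! ### Uniform `L¹` bounds for the kernels. -/

theorem exists_schwartz_iteratedDeriv (g : 𝓢(ℝ, ℂ)) (n : ℕ) :
    ∃ h : 𝓢(ℝ, ℂ), (h : ℝ → ℂ) = iteratedDeriv n g := by
  induction n with
  | zero => exact ⟨g, by simp⟩
  | succ n ih =>
    obtain ⟨h, hh⟩ := ih
    refine ⟨SchwartzMap.derivCLM ℂ ℂ h, ?_⟩
    rw [iteratedDeriv_succ, ← hh]
    ext x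
    simp

theorem norm_fourier_le_of_support {h : ℝ → ℂ} {W : Set ℝ} {C : ℝ} (hW : volume W < ⊤)
    (h0 : ∀ ξ ∉ W, h ξ = 0) (hC : ∀ ξ, ‖h ξ‖ ≤ C) (y : ℝ) :
    ‖𝓕 h y‖ ≤ C * volume.real W := by
  rw [Real.fourier_eq, ← setIntegral_eq_integral_of_forall_compl_eq_zero (s := W)
    fun ξ hξ => by rw [h0 ξ hξ, smul_zero]]
  exact norm_setIntegral_le_of_norm_le_const hW fun ξ _ => by simpa using hC ξ

/-- Fourier inversion of `𝓕 φ` and of its second derivative, both supported in `W`, bounds `|φ x|`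
by `K 0 * V` and `x² |φ x|` by `K 2 / V`, where `V = |W|`. The resulting majorant `V / (1 + (V x)²)`
has integral `π` for every `V`. -/
theorem IsAdaptedBump.norm_mul_le {K : ℕ → ℝ} {W : Set ℝ} {φ : 𝓢(ℝ, ℂ)}
    (h : IsAdaptedBump K W (𝓕 (φ : ℝ → ℂ))) (hW : volume W < ⊤) (hW0 : 0 < volume.real W) (x : ℝ) :
    ‖φ x‖ * (1 + (volume.real W * x) ^ 2) ≤ volume.real W * (|K 0| + |K 2|) := by
  set V := volume.real W with hV
  have hz : ∀ n, ∀ ξ ∉ W, iteratedDeriv n (𝓕 (φ : ℝ → ℂ)) ξ = 0 := fun n ξ hξ => by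
    have : tsupport (iteratedDeriv n (𝓕 (φ : ℝ → ℂ))) ⊆ tsupport (𝓕 (φ : ℝ → ℂ)) := by
      induction n with
      | zero => simp
      | succ n ih => rw [iteratedDeriv_succ]; exact tsupport_deriv_subset.trans ih
    exact image_eq_zero_of_notMem_tsupport fun h' => hξ (h.supp (this h'))
  have hinv : 𝓕 (𝓕 (φ : ℝ → ℂ)) (-x) = φ x := by
    rw [← Real.fourierInv_eq_fourier_neg]
    have h := congrArg (fun g : 𝓢(ℝ, ℂ) => g x)
      (FourierTransform.fourierInv_fourier_eq (F := 𝓢(ℝ, ℂ)) φ)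
    simpa only [SchwartzMap.fourierInv_coe, SchwartzMap.fourier_coe] using h
  have h2 : 𝓕 (iteratedDeriv 2 (𝓕 (φ : ℝ → ℂ))) (-x) =
      (2 * Real.pi * Complex.I * (-x : ℝ)) ^ 2 • φ x := by
    rw [Real.fourier_iteratedDeriv (N := 2) ((𝓕 φ).smooth 2)
      (fun n _ => by
        obtain ⟨g, hg⟩ := exists_schwartz_iteratedDeriv (𝓕 φ) n
        rw [SchwartzMap.fourier_coe] at hg
        exact hg ▸ g.integrable) le_rfl]
    simp only [hinv]
  have b0 := norm_fourier_le_of_support hW (hz 0) (h.bound 0) (-x)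
  have b2 := norm_fourier_le_of_support hW (hz 2) (h.bound 2) (-x)
  rw [iteratedDeriv_zero, hinv, ← hV] at b0
  rw [h2, ← hV, norm_smul] at b2
  have e : ‖(2 * Real.pi * Complex.I * (-x : ℝ)) ^ 2‖ = (2 * Real.pi) ^ 2 * x ^ 2 := by
    simp only [norm_pow, norm_mul, Complex.norm_I, Complex.norm_real, Real.norm_eq_abs, mul_pow,
      sq_abs, Complex.norm_ofNat]
    ring
  rw [e] at b2
  -- The factor `(2π)²` produced by differentiating twice only helps and is dropped.
  have hpi : 1 ≤ (2 * Real.pi) ^ 2 := by nlinarith [Real.pi_gt_three]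
  have b2' : x ^ 2 * ‖φ x‖ ≤ K 2 * (V ^ 2)⁻¹ * V := by
    refine le_trans ?_ b2
    rw [mul_assoc]
    exact le_mul_of_one_le_left (by positivity) hpi
  have b2'' : V ^ 2 * (x ^ 2 * ‖φ x‖) ≤ V * K 2 := by
    calc _ ≤ V ^ 2 * (K 2 * (V ^ 2)⁻¹ * V) := by gcongr
      _ = V * K 2 := by field_simp
  calc _ = ‖φ x‖ + V ^ 2 * (x ^ 2 * ‖φ x‖) := by ring
    _ ≤ K 0 * (V ^ 0)⁻¹ * V + V * K 2 := add_le_add b0 b2''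
    _ = V * (K 0 + K 2) := by simp; ring
    _ ≤ _ := by gcongr <;> exact le_abs_self _

theorem IsAdaptedBump.integral_norm_le {K : ℕ → ℝ} {W : Set ℝ} {φ : 𝓢(ℝ, ℂ)}
    (h : IsAdaptedBump K W (𝓕 (φ : ℝ → ℂ))) (hW : volume W < ⊤) (hW0 : 0 < volume.real W) :
    ∫ x, ‖φ x‖ ≤ (|K 0| + |K 2|) * Real.pi := by
  set V := volume.real W with hV
  have hint : Integrable fun x : ℝ => V * (|K 0| + |K 2|) * (1 + (V * x) ^ 2)⁻¹ :=
    (integrable_inv_one_add_sq.comp_mul_left' hW0.ne').const_mul _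
  calc _ ≤ ∫ x : ℝ, V * (|K 0| + |K 2|) * (1 + (V * x) ^ 2)⁻¹ := by
        refine integral_mono φ.integrable.norm hint fun x => ?_
        rw [← div_eq_mul_inv, le_div_iff₀ (by positivity)]
        exact h.norm_mul_le hW hW0 x
    _ = _ := by
        rw [integral_const_mul, Measure.integral_comp_mul_left (fun y : ℝ => (1 + y ^ 2)⁻¹) V,
          integral_univ_inv_one_add_sq, abs_of_pos (inv_pos.2 hW0), smul_eq_mul]
        field_simp

theorem norm_fourier_le_integral_norm (φ : ℝ → ℂ) (ξ : ℝ) : ‖𝓕 φ ξ‖ ≤ ∫ x, ‖φ x‖ := by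
  rw [Real.fourier_eq]
  refine (norm_integral_le_integral_norm _).trans_eq ?_
  simp

theorem exists_schwartz_dilate (Φ : 𝓢(ℝ, ℂ)) {w : ℝ} (hw : w ≠ 0) :
    ∃ φ : 𝓢(ℝ, ℂ), (φ : ℝ → ℂ) = dilate Φ w :=
  ⟨(w : ℂ) • SchwartzMap.compCLMOfContinuousLinearEquiv ℂ
    (ContinuousLinearEquiv.unitsEquivAut ℝ (Units.mk0 w hw)) Φ, by
      ext x
      simp [dilate, mul_comm x w]⟩

theorem integral_norm_dilate (Φ : 𝓢(ℝ, ℂ)) {w : ℝ} (hw : 0 < w) :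
    ∫ x, ‖dilate Φ w x‖ = ∫ x, ‖Φ x‖ := by
  simp only [dilate, norm_mul, Complex.norm_real, Real.norm_eq_abs, abs_of_pos hw]
  rw [integral_const_mul, Measure.integral_comp_mul_left (fun y : ℝ => ‖Φ y‖) w,
    abs_of_pos (inv_pos.2 hw), smul_eq_mul, mul_inv_cancel_left₀ hw.ne']

/-! ### Lacunarity and bounded overlap of the frequency windows. -/

theorem annulus_eq {a b : ℝ} (ha : 0 < a) :
    annulus a b = Set.Icc (-b) (-a) ∪ Set.Icc a b := by
  ext ξ
  simp only [annulus, Set.mem_ofPred_eq, Set.mem_union, Set.mem_Icc]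
  rcases abs_cases ξ with h | h <;> rw [h.1] <;> constructor
  · exact fun h => Or.inr h
  · rintro (⟨_, _⟩ | h)
    · constructor <;> linarith
    · exact h
  · exact fun h => Or.inl ⟨by linarith, by linarith⟩
  · rintro (⟨_, _⟩ | ⟨_, _⟩) <;> constructor <;> linarith

theorem volume_annulus {a b : ℝ} (ha : 0 < a) (hab : a ≤ b) :
    volume (annulus a b) = ENNReal.ofReal (2 * (b - a)) := by
  rw [annulus_eq ha, measure_union _ measurableSet_Icc, Real.volume_Icc, Real.volume_Icc,
    ← ENNReal.ofReal_add (by linarith) (by linarith)]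
  · congr 1; ring
  · exact Set.disjoint_left.2 fun x h1 h2 => by linarith [h1.2, h2.1]

theorem volume_real_annulus {a b : ℝ} (ha : 0 < a) (hab : a ≤ b) :
    volume.real (annulus a b) = 2 * (b - a) := by
  rw [Measure.real, volume_annulus ha hab, ENNReal.toReal_ofReal (by linarith)]

theorem w₁_pos (P : Params) (j : ℤ) : 0 < w₁ P j := by unfold w₁; positivity

theorem w₂_pos (P : Params) (j : ℤ) : 0 < w₂ P j := by unfold w₂; positivity

/-- The indices `j` for which one of the first two windows is at least ten times as long as the
other one. -/
def separated (P : Params) : Set ℤ :=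
  {j | volume.real (omega P 1 j) ≤ volume.real (omega P 0 j) / 10 ∨
    volume.real (omega P 0 j) ≤ volume.real (omega P 1 j) / 10}

/-- The first two windows have measure `3 w₁` and `3 w₂`, so a ratio of ten exceeds the threshold 8
in `omega₃` and excludes the case of a window around the origin. -/
theorem omega₃_of_separated (P : Params) {j : ℤ} (hj : j ∈ separated P) :
    omega P 2 j = annulus (w₁ P j / 8) (19 * w₁ P j / 8) ∨
      omega P 2 j = annulus (w₂ P j / 8) (19 * w₂ P j / 8) := by
  have h1 := w₁_pos P j
  have h2 := w₂_pos P j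
  have e0 : volume.real (omega P 0 j) = 2 * (2 * w₁ P j - w₁ P j / 2) :=
    volume_real_annulus (by positivity) (by linarith)
  have e1 : volume.real (omega P 1 j) = 2 * (2 * w₂ P j - w₂ P j / 2) :=
    volume_real_annulus (by positivity) (by linarith)
  have hj : _ ∨ _ := hj
  rw [e0, e1] at hj
  change omega₃ P j = _ ∨ omega₃ P j = _
  unfold omega₃
  rcases hj with hj | hj
  · left
    rw [if_pos (by linarith)]
  · right
    rw [if_neg (by linarith), if_pos (by linarith)]

/-- The bounds `w / 8` and `4 w` are loose enough for all three families. Two admissible indices `i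
≤ j` satisfy `2 ^ (L (j - i)) ≤ 32`, hence `j - i ≤ 5` because `L ≥ 1`. -/
theorem card_le_six_of_lacunary {L : ℕ} (hL : 0 < L) (M : ℤ) (ξ : ℝ) (s : Finset ℤ)
    (hs : ∀ j ∈ s, (2 : ℝ) ^ ((L : ℤ) * j + M) / 8 ≤ |ξ| ∧
      |ξ| ≤ 4 * (2 : ℝ) ^ ((L : ℤ) * j + M)) : s.card ≤ 6 := by
  rcases s.eq_empty_or_nonempty with rfl | hne
  · simp
  have hsub : s ⊆ Finset.Icc (s.min' hne) (s.min' hne + 5) := by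
    intro j hj
    rw [Finset.mem_Icc]
    refine ⟨s.min'_le j hj, ?_⟩
    set i := s.min' hne
    have hi := (hs i (s.min'_mem hne)).2
    have hj' := (hs j hj).1
    have h32 : (2 : ℝ) ^ ((L : ℤ) * j + M) ≤ 2 ^ ((5 : ℤ) + (L * i + M)) := by
      rw [zpow_add₀ (two_ne_zero' ℝ) 5]
      norm_num
      linarith
    have := (zpow_le_zpow_iff_right₀ (one_lt_two : (1 : ℝ) < 2)).1 h32
    have hL' : (1 : ℤ) ≤ L := by exact_mod_cast hL
    by_contra hlt
    push Not at hlt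
    nlinarith
  have := Finset.card_le_card hsub
  rw [Int.card_Icc] at this
  omega

theorem sum_enorm_sq_le_of_card {ι : Type*} (s : Finset ι) (a : ι → ℂ) {c : ℝ} {N : ℕ}
    (hc : ∀ j ∈ s, ‖a j‖ ≤ c) (hN : (s.filter fun j => a j ≠ 0).card ≤ N) :
    ∑ j ∈ s, ‖a j‖ₑ ^ 2 ≤ N * ENNReal.ofReal c ^ 2 := by
  rw [← Finset.sum_filter_of_ne (p := fun j => a j ≠ 0) fun j _ h h0 => h (by simp [h0])]
  calc _ ≤ ∑ j ∈ s.filter fun j => a j ≠ 0, ENNReal.ofReal c ^ 2 := by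
        refine Finset.sum_le_sum fun j hj => ?_
        rw [← ofReal_norm]
        gcongr
        exact hc j (Finset.mem_filter.1 hj).1
    _ ≤ _ := by
        rw [Finset.sum_const, nsmul_eq_mul]
        gcongr

theorem exists_schwartz_kernel (P : Params) (Φ : 𝓢(ℝ, ℂ)) (Φ₃ : ℤ → 𝓢(ℝ, ℂ)) :
    ∃ φ : Fin 3 → ℤ → 𝓢(ℝ, ℂ), ∀ ℓ j, (φ ℓ j : ℝ → ℂ) = kernel P Φ Φ₃ ℓ j := by
  have : ∀ ℓ j, ∃ φ : 𝓢(ℝ, ℂ), (φ : ℝ → ℂ) = kernel P Φ Φ₃ ℓ j := by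
    intro ℓ j
    fin_cases ℓ
    · exact exists_schwartz_dilate Φ (w₁_pos P j).ne'
    · exact exists_schwartz_dilate Φ (w₂_pos P j).ne'
    · exact ⟨Φ₃ j, rfl⟩
  choose φ hφ using this
  exact ⟨φ, hφ⟩

/-- A common bound for the `L¹` norms of all kernels and for their Fourier transforms. -/
noncomputable def kernelBound (Φ : 𝓢(ℝ, ℂ)) (K : ℕ → ℝ) : ℝ :=
  -- The summand 1 makes the bound strictly positive, as the interpolation requires of `D`.
  1 + (∫ x, ‖Φ x‖) + (|K 0| + |K 2|) * Real.pi

theorem kernelBound_pos (Φ : 𝓢(ℝ, ℂ)) (K : ℕ → ℝ) : 0 < kernelBound Φ K := by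
  have : 0 ≤ ∫ x, ‖Φ x‖ := integral_nonneg fun _ => norm_nonneg _
  have := Real.pi_pos
  unfold kernelBound
  positivity

theorem integral_norm_kernel_le {K : ℕ → ℝ} {P : Params} (Φ : 𝓢(ℝ, ℂ)) {Φ₃ : ℤ → 𝓢(ℝ, ℂ)}
    (h₃ : IsThirdFamily K P Φ₃) (ℓ : Fin 3) {j : ℤ} (hj : j ∈ separated P) :
    ∫ x, ‖kernel P Φ Φ₃ ℓ j x‖ ≤ kernelBound Φ K := by
  have h0 : 0 ≤ ∫ x, ‖Φ x‖ := integral_nonneg fun _ => norm_nonneg _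
  have h1 : 0 ≤ (|K 0| + |K 2|) * Real.pi := by positivity
  have h2 := w₁_pos P j
  have h3 := w₂_pos P j
  unfold kernelBound
  fin_cases ℓ
  · exact (integral_norm_dilate Φ h2).trans_le (by linarith)
  · exact (integral_norm_dilate Φ h3).trans_le (by linarith)
  · refine ((h₃.adapted j).integral_norm_le ?_ ?_).trans (by linarith)
    · rcases omega₃_of_separated P hj with h | h <;>
        rw [h, volume_annulus (by positivity) (by linarith)] <;> exact ENNReal.ofReal_lt_top
    · rcases omega₃_of_separated P hj with h | h <;>
        rw [h, volume_real_annulus (by positivity) (by linarith)] <;> linarith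

theorem mem_annulus_of_fourier_dilate_ne_zero {Φ : 𝓢(ℝ, ℂ)}
    (hΦ : tsupport (𝓕 (Φ : ℝ → ℂ)) ⊆ Set.Icc (1 / 2) 2) {w ξ : ℝ} (hw : 0 < w)
    (h : 𝓕 (dilate Φ w) ξ ≠ 0) : w / 8 ≤ |ξ| ∧ |ξ| ≤ 4 * w := by
  rw [fourier_dilate Φ hw] at h
  obtain ⟨h1, h2⟩ := hΦ (subset_tsupport _ h)
  rw [le_div_iff₀ hw] at h1
  rw [div_le_iff₀ hw] at h2
  rw [abs_of_pos (by linarith)]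
  constructor <;> linarith

theorem card_fourier_kernel_ne_zero_le {K : ℕ → ℝ} {P : Params} {Φ : 𝓢(ℝ, ℂ)}
    (hΦ : tsupport (𝓕 (Φ : ℝ → ℂ)) ⊆ Set.Icc (1 / 2) 2) {Φ₃ : ℤ → 𝓢(ℝ, ℂ)}
    (h₃ : IsThirdFamily K P Φ₃) (ℓ : Fin 3) (ξ : ℝ) (s : Finset ℤ)
    (hs : ∀ j ∈ s, j ∈ separated P ∧ 𝓕 (kernel P Φ Φ₃ ℓ j) ξ ≠ 0) : s.card ≤ 12 := by
  classical
  fin_cases ℓ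
  · exact (card_le_six_of_lacunary P.L₁_pos P.M₁ ξ s fun j hj =>
      mem_annulus_of_fourier_dilate_ne_zero hΦ (w₁_pos P j) (hs j hj).2).trans (by norm_num)
  · exact (card_le_six_of_lacunary P.L₂_pos P.M₂ ξ s fun j hj =>
      mem_annulus_of_fourier_dilate_ne_zero hΦ (w₂_pos P j) (hs j hj).2).trans (by norm_num)
  -- The third windows follow `w₁` for some `j` and `w₂` for the others. Each subfamily is lacunary
  -- and contributes at most 6.
  · rw [← Finset.card_filter_add_card_filter_not
      (fun j => omega P 2 j = annulus (w₁ P j / 8) (19 * w₁ P j / 8))]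
    have hm : ∀ j ∈ s, ξ ∈ omega P 2 j := fun j hj =>
      (h₃.adapted j).supp (subset_tsupport _ (hs j hj).2)
    refine (add_le_add (card_le_six_of_lacunary P.L₁_pos P.M₁ ξ _ fun j hj => ?_)
      (card_le_six_of_lacunary P.L₂_pos P.M₂ ξ _ fun j hj => ?_)).trans (by norm_num : 6 + 6 ≤ 12)
    · obtain ⟨hj1, hj2⟩ := Finset.mem_filter.1 hj
      have h := hm j hj1
      rw [hj2] at h
      have hw := w₁_pos P j
      exact ⟨h.1, h.2.trans (by change _ ≤ 4 * w₁ P j; linarith)⟩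
    · obtain ⟨hj1, hj2⟩ := Finset.mem_filter.1 hj
      have h := hm j hj1
      rw [(omega₃_of_separated P (hs j hj1).1).resolve_left hj2] at h
      have hw := w₂_pos P j
      exact ⟨h.1, h.2.trans (by change _ ≤ 4 * w₂ P j; linarith)⟩

theorem sum_enorm_fourier_kernel_sq_le {K : ℕ → ℝ} {P : Params} {Φ : 𝓢(ℝ, ℂ)}
    (hΦ : tsupport (𝓕 (Φ : ℝ → ℂ)) ⊆ Set.Icc (1 / 2) 2) {Φ₃ : ℤ → 𝓢(ℝ, ℂ)}
    (h₃ : IsThirdFamily K P Φ₃) (ℓ : Fin 3) (s : Finset (separated P)) (ξ : ℝ) :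
    ∑ j ∈ s, ‖𝓕 (kernel P Φ Φ₃ ℓ j) ξ‖ₑ ^ 2 ≤ 12 * ENNReal.ofReal (kernelBound Φ K) ^ 2 := by
  refine sum_enorm_sq_le_of_card s (fun j : separated P => 𝓕 (kernel P Φ Φ₃ ℓ j) ξ) (N := 12)
    (fun j _ => (norm_fourier_le_integral_norm _ ξ).trans (integral_norm_kernel_le Φ h₃ ℓ j.2)) ?_
  rw [← Finset.card_map (Function.Embedding.subtype _)]
  refine card_fourier_kernel_ne_zero_le hΦ h₃ ℓ ξ _ fun j hj => ?_
  simp only [Finset.mem_map, Finset.mem_filter, Function.Embedding.subtype_apply] at hj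
  obtain ⟨a, ⟨_, ha⟩, rfl⟩ := hj
  exact ⟨a.2, ha⟩

/-- The constant in `tsum_lintegral_localized_rpow_le`. -/
noncomputable def localizedConst (Φ : 𝓢(ℝ, ℂ)) (K : ℕ → ℝ) (p : ℝ) : ℝ≥0∞ :=
  interpolationConst (12 * ENNReal.ofReal (kernelBound Φ K) ^ 2) (kernelBound Φ K) p

theorem localizedConst_ne_top (Φ : 𝓢(ℝ, ℂ)) (K : ℕ → ℝ) {p : ℝ} (hp : 2 < p) :
    localizedConst Φ K p ≠ ⊤ :=
  interpolationConst_ne_top (by finiteness) _ hp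

/-- Neither the overlap count 12 nor `kernelBound` involves the widths and overlap parameters in
`P`, so the constant is uniform in them. -/
theorem tsum_lintegral_localized_rpow_le {K : ℕ → ℝ} {P : Params} {Φ : 𝓢(ℝ, ℂ)}
    (hΦ : tsupport (𝓕 (Φ : ℝ → ℂ)) ⊆ Set.Icc (1 / 2) 2) {Φ₃ : ℤ → 𝓢(ℝ, ℂ)}
    (h₃ : IsThirdFamily K P Φ₃) (f : Fin 3 → ℝ → ℂ) (ℓ : Fin 3) {p : ℝ} (hp : 2 < p)
    (hf : MemLp (f ℓ) (ENNReal.ofReal p)) :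
    ∑' j : separated P, ∫⁻ x, ‖localized P Φ Φ₃ f ℓ j x‖ₑ ^ p ≤
      localizedConst Φ K p * ∫⁻ x, ‖f ℓ x‖ₑ ^ p := by
  obtain ⟨φ, hφ⟩ := exists_schwartz_kernel P Φ Φ₃
  have := tsum_lintegral_convolution_rpow_le (fun j : separated P => φ ℓ j)
    (B := 12 * ENNReal.ofReal (kernelBound Φ K) ^ 2) (by finiteness)
    (fun s ξ => by simpa only [hφ] using sum_enorm_fourier_kernel_sq_le hΦ h₃ ℓ s ξ)
    (kernelBound_pos Φ K)
    (fun j => by simpa only [hφ] using integral_norm_kernel_le Φ h₃ ℓ j.2) hp hf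
  simpa only [hφ, localized, localizedConst] using this

theorem aestronglyMeasurable_localized (P : Params) (Φ : 𝓢(ℝ, ℂ)) (Φ₃ : ℤ → 𝓢(ℝ, ℂ))
    {f : Fin 3 → ℝ → ℂ} {ℓ : Fin 3} (hf : AEStronglyMeasurable (f ℓ)) (j : ℤ) :
    AEStronglyMeasurable (localized P Φ Φ₃ f ℓ j) := by
  obtain ⟨φ, hφ⟩ := exists_schwartz_kernel P Φ Φ₃
  unfold localized
  rw [← hφ]
  exact aestronglyMeasurable_convolution hf _

/-! ### The spatial cutoffs. -/

theorem IsCutoff.integral_eq_one {ψ : 𝓢(ℝ, ℝ)} (hψ : IsCutoff ψ) : ∫ x, ψ x = 1 := by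
  have h := hψ.one
  rw [Real.fourier_eq] at h
  simp only [inner_zero_right, neg_zero, AddChar.map_zero_eq_one, one_smul] at h
  rw [integral_complex_ofReal] at h
  exact_mod_cast h

theorem integrable_rescale (ψ : 𝓢(ℝ, ℝ)) (k : ℤ) :
    Integrable fun x : ℝ => (2 : ℝ) ^ k * ψ ((2 : ℝ) ^ k * x) :=
  ((ψ.integrable (μ := volume)).comp_mul_left' (by positivity)).const_mul _

theorem IsCutoff.integral_rescale {ψ : 𝓢(ℝ, ℝ)} (hψ : IsCutoff ψ) (k : ℤ) :
    ∫ x : ℝ, (2 : ℝ) ^ k * ψ ((2 : ℝ) ^ k * x) = 1 := by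
  have hk : (0 : ℝ) < 2 ^ k := by positivity
  rw [integral_const_mul, Measure.integral_comp_mul_left (fun y : ℝ => ψ y),
    hψ.integral_eq_one, abs_of_pos (inv_pos.2 hk), smul_eq_mul, mul_one, mul_inv_cancel₀ hk.ne']

theorem smoothInd_nonneg {ψ : 𝓢(ℝ, ℝ)} (hψ : IsCutoff ψ) (k n : ℤ) (x : ℝ) :
    0 ≤ smoothInd ψ k n x := by
  refine integral_nonneg fun t => ?_
  have := hψ.nonneg ((2 : ℝ) ^ k * (x - t))
  have h : 0 ≤ (dyadic k n).indicator (fun _ => (1 : ℝ)) t :=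
    Set.indicator_nonneg (fun _ _ => zero_le_one) t
  simp only [ContinuousLinearMap.mul_apply']
  positivity

theorem integrable_indicator_dyadic (k n : ℤ) :
    Integrable ((dyadic k n).indicator fun _ => (1 : ℝ)) :=
  (integrable_indicator_iff measurableSet_Icc).2
    (integrableOn_const (by simp) (by simp))

theorem aestronglyMeasurable_smoothInd (ψ : 𝓢(ℝ, ℝ)) (k n : ℤ) :
    AEStronglyMeasurable (smoothInd ψ k n) :=
  ((integrable_indicator_dyadic k n).integrable_convolution _
    (integrable_rescale ψ k)).aestronglyMeasurable

/-- The closed intervals overlap only at endpoints. Up to a null set they partition the line, so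
their indicators sum to at most 1, and smoothing by a kernel of integral 1 keeps this bound. -/
theorem indicator_dyadic_ae_eq (k n : ℤ) :
    (dyadic k n).indicator (fun _ => (1 : ℝ)) =ᵐ[volume]
      fun t => if n = ⌊(2 : ℝ) ^ k * t⌋ then (1 : ℝ) else 0 := by
  have hk : (0 : ℝ) < 2 ^ k := by positivity
  have h : (dyadic k n : Set ℝ) =ᵐ[volume]
      Set.Ico ((2 : ℝ) ^ (-k) * n) ((2 : ℝ) ^ (-k) * (n + 1)) := Ico_ae_eq_Icc.symm
  filter_upwards [indicator_ae_eq_of_ae_eq_set (f := fun _ => (1 : ℝ)) h] with t ht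
  rw [ht, Set.indicator_apply]
  congr 1
  rw [Set.mem_Ico, eq_comm (a := n), Int.floor_eq_iff, zpow_neg, inv_mul_le_iff₀ hk,
    lt_inv_mul_iff₀ hk]

theorem sum_smoothInd_le_one {ψ : 𝓢(ℝ, ℝ)} (hψ : IsCutoff ψ) (k : ℤ) (s : Finset ℤ) (x : ℝ) :
    ∑ n ∈ s, smoothInd ψ k n x ≤ 1 := by
  set q : ℝ → ℝ := fun y => (2 : ℝ) ^ k * ψ ((2 : ℝ) ^ k * y) with hq
  have hq0 : ∀ y, 0 ≤ q y := fun y => mul_nonneg (by positivity) (hψ.nonneg _)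
  have hqi : Integrable fun t => q (x - t) := (integrable_rescale ψ k).comp_sub_left x
  have hi : ∀ n : ℤ, Integrable fun t => (dyadic k n).indicator (fun _ => (1 : ℝ)) t * q (x - t) :=
    fun n => hqi.bdd_mul (c := 1) (integrable_indicator_dyadic k n).aestronglyMeasurable
      (ae_of_all _ fun t => by
        refine (norm_indicator_le_norm_self _ _).trans ?_
        simp)
  calc ∑ n ∈ s, smoothInd ψ k n x
      = ∫ t, ∑ n ∈ s, (dyadic k n).indicator (fun _ => (1 : ℝ)) t * q (x - t) :=
        (integral_finsetSum s fun n _ => hi n).symm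
    _ ≤ ∫ t, q (x - t) := by
        refine integral_mono_ae (integrable_finsetSum s fun n _ => hi n) hqi ?_
        filter_upwards [ae_all_iff.2 (indicator_dyadic_ae_eq k)] with t ht
        simp only [ht, ← Finset.sum_mul, Finset.sum_ite_eq']
        refine mul_le_of_le_one_left (hq0 _) ?_
        split_ifs <;> simp
    _ = 1 := by
        rw [integral_sub_left_eq_self q volume x]
        exact hψ.integral_rescale k

/-- The sum of the cutoff functions of the intervals of `S` at level `j`. -/
noncomputable def cutoffSum (ψ : 𝓢(ℝ, ℝ)) (k : ℤ) (N : Set ℤ) (x : ℝ) : ℝ :=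
  ∑' n : N, smoothInd ψ k n x

theorem sum_smoothInd_subtype_le_one {ψ : 𝓢(ℝ, ℝ)} (hψ : IsCutoff ψ) (k : ℤ) (N : Set ℤ)
    (s : Finset N) (x : ℝ) : ∑ n ∈ s, smoothInd ψ k n x ≤ 1 := by
  have := sum_smoothInd_le_one hψ k (s.map (Function.Embedding.subtype _)) x
  rwa [Finset.sum_map] at this

theorem summable_smoothInd {ψ : 𝓢(ℝ, ℝ)} (hψ : IsCutoff ψ) (k : ℤ) (N : Set ℤ) (x : ℝ) :
    Summable fun n : N => smoothInd ψ k n x :=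
  summable_of_sum_le (fun n => smoothInd_nonneg hψ k n x)
    fun s => sum_smoothInd_subtype_le_one hψ k N s x

theorem norm_cutoffSum_le {ψ : 𝓢(ℝ, ℝ)} (hψ : IsCutoff ψ) (k : ℤ) (N : Set ℤ) (x : ℝ) :
    ‖cutoffSum ψ k N x‖ ≤ 1 := by
  have h0 : 0 ≤ cutoffSum ψ k N x := tsum_nonneg fun n : N => smoothInd_nonneg hψ k n x
  rw [Real.norm_of_nonneg h0]
  exact (summable_smoothInd hψ k N x).tsum_le_of_sum_le
    fun s => sum_smoothInd_subtype_le_one hψ k N s x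

theorem aestronglyMeasurable_cutoffSum (ψ : 𝓢(ℝ, ℝ)) (k : ℤ) (N : Set ℤ) :
    AEStronglyMeasurable (cutoffSum ψ k N) :=
  (AEMeasurable.tsum fun n : N =>
    (aestronglyMeasurable_smoothInd ψ k n).aemeasurable).aestronglyMeasurable

/-! ### Reduction of each term to the localized functions. -/

section Term

variable {P : Params} {Φ : 𝓢(ℝ, ℂ)} {Φ₃ : ℤ → 𝓢(ℝ, ℂ)} {ψ : 𝓢(ℝ, ℝ)} {k : Fin 3 → ℤ → ℤ} {m : ℕ}
  {f : Fin 3 → ℝ → ℂ}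

theorem summable_piece (hψ : IsCutoff ψ) (ℓ : Fin 3) (j : ℤ) (N : Set ℤ) (x : ℝ) :
    Summable fun n : N => piece P Φ Φ₃ ψ k m f ℓ j n x :=
  (Complex.ofRealCLM.summable (summable_smoothInd hψ (minScale k j) N _)).mul_right _

theorem tsum_piece (ℓ : Fin 3) (j : ℤ) (N : Set ℤ) (x : ℝ) :
    ∑' n : N, piece P Φ Φ₃ ψ k m f ℓ j n x =
      (cutoffSum ψ (minScale k j) N (x + shift P m ℓ j) : ℂ) *
        localized P Φ Φ₃ f ℓ j (x + shift P m ℓ j) := by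
  simp only [piece, cutoffSum, tsum_mul_right, Complex.ofReal_tsum]

theorem aestronglyMeasurable_term (hf : ∀ ℓ, AEStronglyMeasurable (f ℓ)) (S : Set (ℤ × ℤ)) (j : ℤ) :
    AEStronglyMeasurable (term P Φ Φ₃ ψ k m S f j) := by
  have : term P Φ Φ₃ ψ k m S f j = fun x => ∏ ℓ : Fin 3,
      (cutoffSum ψ (minScale k j) {n | (j, n) ∈ S} (x + shift P m ℓ j) : ℂ) *
        localized P Φ Φ₃ f ℓ j (x + shift P m ℓ j) :=
    funext fun x => Finset.prod_congr rfl fun ℓ _ => tsum_piece ℓ j {n | (j, n) ∈ S} x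
  rw [this]
  refine Finset.aestronglyMeasurable_fun_prod _ fun ℓ _ => ?_
  have mp := (measurePreserving_add_right volume (shift P m ℓ j)).quasiMeasurePreserving
  exact (Complex.continuous_ofReal.comp_aestronglyMeasurable
    ((aestronglyMeasurable_cutoffSum ψ _ _).comp_quasiMeasurePreserving mp)).mul
    ((aestronglyMeasurable_localized P Φ Φ₃ (hf ℓ) j).comp_quasiMeasurePreserving mp)

/-- The localized function does not depend on `n`, so by `tsum_piece` the set `S` enters only
through a factor in `[0, 1]`. -/
theorem enorm_term_le (hψ : IsCutoff ψ) (S : Set (ℤ × ℤ)) (j : ℤ) (x : ℝ) :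
    ‖term P Φ Φ₃ ψ k m S f j x‖ₑ ≤
      ∏ ℓ : Fin 3, ‖localized P Φ Φ₃ f ℓ j (x + shift P m ℓ j)‖ₑ := by
  have h : ∀ ℓ, ‖∑' n : {n : ℤ // (j, n) ∈ S}, piece P Φ Φ₃ ψ k m f ℓ j n x‖ₑ ≤
      ‖localized P Φ Φ₃ f ℓ j (x + shift P m ℓ j)‖ₑ := fun ℓ => by
    rw [show ∑' n : {n : ℤ // (j, n) ∈ S}, piece P Φ Φ₃ ψ k m f ℓ j n x = _ from
      tsum_piece ℓ j {n | (j, n) ∈ S} x, enorm_mul]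
    refine mul_le_of_le_one_left' ?_
    rw [← ofReal_norm, Complex.norm_real, ← ENNReal.ofReal_one]
    exact ENNReal.ofReal_le_ofReal (norm_cutoffSum_le hψ _ _ _)
  simp only [term, Fin.prod_univ_three, enorm_mul]
  exact mul_le_mul' (mul_le_mul' (h 0) (h 1)) (h 2)

theorem term_eq_zero_of_notMem_separated (S : Set (ℤ × ℤ)) {j : ℤ} (hj : j ∉ separated P) :
    term P Φ Φ₃ ψ k m (goodPart P S) f j = 0 := by
  have : IsEmpty {n : ℤ // (j, n) ∈ goodPart P S} := ⟨fun n => hj n.2.2⟩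
  ext x
  simp [term]

end Term

/-! ### Hölder's inequality and summation of the terms. -/

/-- Hölder's inequality in `L^q(ℓ^q)` for finitely many functions. -/
theorem tsum_lintegral_prod_le {ι κ : Type*} [Countable ι] [Fintype κ]
    (a : κ → ι → ℝ → ℝ≥0∞) (ha : ∀ ℓ j, AEMeasurable (a ℓ j)) (q : κ → ℝ) (hq : ∀ ℓ, 0 < q ℓ)
    (hsum : ∑ ℓ, 1 / q ℓ = 1) :
    ∑' j, ∫⁻ x, ∏ ℓ, a ℓ j x ≤ ∏ ℓ, (∑' j, ∫⁻ x, a ℓ j x ^ q ℓ) ^ (1 / q ℓ) := by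
  -- The sum over `j` becomes an integral for counting measure, so the same Hölder inequality serves
  -- in `x` and then in `j`.
  let _ : MeasurableSpace ι := ⊤
  have h0 : ∀ ℓ ∈ Finset.univ, 0 ≤ 1 / q ℓ := fun ℓ _ => (one_div_pos.2 (hq ℓ)).le
  have h1 : ∀ j, ∫⁻ x, ∏ ℓ, a ℓ j x ≤ ∏ ℓ, (∫⁻ x, a ℓ j x ^ q ℓ) ^ (1 / q ℓ) := fun j => by
    refine le_of_eq_of_le ?_ (ENNReal.lintegral_prod_norm_pow_le Finset.univ
      (fun ℓ _ => (ha ℓ j).pow_const (q ℓ)) hsum h0)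
    refine lintegral_congr fun x => Finset.prod_congr rfl fun ℓ _ => ?_
    rw [← ENNReal.rpow_mul, mul_one_div_cancel (hq ℓ).ne', ENNReal.rpow_one]
  refine (ENNReal.tsum_le_tsum h1).trans ?_
  simp only [← lintegral_count]
  exact ENNReal.lintegral_prod_norm_pow_le Finset.univ
    (fun ℓ _ => Measurable.of_discrete.aemeasurable) hsum h0

theorem integrable_tsum_of_tsum_lintegral {ι : Type*} [Countable ι] {F : ι → ℝ → ℂ}
    (hF : ∀ j, AEStronglyMeasurable (F j)) {T : ℝ≥0∞} (hT : T ≠ ⊤)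
    (h : ∑' j, ∫⁻ x, ‖F j x‖ₑ ≤ T) :
    (∀ᵐ x, Summable fun j => F j x) ∧ Integrable (fun x => ∑' j, F j x) ∧
      ‖∫ x, ∑' j, F j x‖ ≤ T.toReal := by
  rw [← lintegral_tsum fun j => (hF j).enorm] at h
  have hle : ∫⁻ x, ‖∑' j, F j x‖ₑ ≤ T :=
    (lintegral_mono fun x => enorm_tsum_le_tsum_enorm).trans h
  refine ⟨?_, ⟨(AEMeasurable.tsum fun j => (hF j).aemeasurable).aestronglyMeasurable,
    hle.trans_lt hT.lt_top⟩, ?_⟩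
  · filter_upwards [ae_lt_top' (AEMeasurable.tsum fun j => (hF j).enorm)
      (ne_top_of_le_ne_top hT h)] with x hx
    exact (tsum_enorm_ne_top_iff_summable_norm.1 hx.ne).of_norm
  · rw [← toReal_enorm]
    exact ENNReal.toReal_mono hT ((enorm_integral_le_lintegral_enorm _).trans hle)

theorem eLpNorm_ofReal_eq {p : ℝ} (hp : 0 < p) (f : ℝ → ℂ) :
    eLpNorm f (ENNReal.ofReal p) volume = (∫⁻ x, ‖f x‖ₑ ^ p) ^ (1 / p) := by
  rw [eLpNorm_eq_lintegral_rpow_enorm_toReal (by simpa using hp) ENNReal.ofReal_ne_top,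
    ENNReal.toReal_ofReal hp.le]

/-- The estimate for the sum of the `L¹` norms of the terms of the trilinear form. -/
theorem tsum_lintegral_term_le {q : Fin 3 → ℝ} (hq : ∀ ℓ, 2 < q ℓ) (hsum : ∑ ℓ, 1 / q ℓ = 1)
    {K : ℕ → ℝ} {P : Params} {Φ : 𝓢(ℝ, ℂ)}
    (hΦ : tsupport (𝓕 (Φ : ℝ → ℂ)) ⊆ Set.Icc (1 / 2) 2) {Φ₃ : ℤ → 𝓢(ℝ, ℂ)}
    (h₃ : IsThirdFamily K P Φ₃) {ψ : 𝓢(ℝ, ℝ)} (hψ : IsCutoff ψ) (k : Fin 3 → ℤ → ℤ) (m : ℕ)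
    (S : Set (ℤ × ℤ)) {f : Fin 3 → ℝ → ℂ} (hf : ∀ ℓ, MemLp (f ℓ) (ENNReal.ofReal (q ℓ))) :
    ∑' j, ∫⁻ x, ‖term P Φ Φ₃ ψ k m (goodPart P S) f j x‖ₑ ≤
      ∏ ℓ, localizedConst Φ K (q ℓ) ^ (1 / q ℓ) * eLpNorm (f ℓ) (ENNReal.ofReal (q ℓ)) volume := by
  have hq0 : ∀ ℓ, 0 < q ℓ := fun ℓ => by linarith [hq ℓ]
  have hsupp : (Function.support fun j =>
      ∫⁻ x, ‖term P Φ Φ₃ ψ k m (goodPart P S) f j x‖ₑ) ⊆ separated P := fun j hj => by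
    by_contra hj'
    exact hj (by simp [term_eq_zero_of_notMem_separated S hj'])
  rw [← tsum_subtype_eq_of_support_subset hsupp]
  have hm : ∀ ℓ (j : separated P), AEMeasurable fun x =>
      ‖localized P Φ Φ₃ f ℓ j (x + shift P m ℓ j)‖ₑ := fun ℓ j =>
    ((aestronglyMeasurable_localized P Φ Φ₃ (hf ℓ).1 j).comp_quasiMeasurePreserving
      (measurePreserving_add_right volume (shift P m ℓ j)).quasiMeasurePreserving).enorm
  refine (ENNReal.tsum_le_tsum fun j : separated P =>
    lintegral_mono fun x => enorm_term_le hψ (goodPart P S) (j : ℤ) x).trans ?_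
  refine (tsum_lintegral_prod_le (fun ℓ (j : separated P) x =>
    ‖localized P Φ Φ₃ f ℓ j (x + shift P m ℓ j)‖ₑ) hm q hq0 hsum).trans ?_
  refine Finset.prod_le_prod' fun ℓ _ => ?_
  -- The shift varies with `j`, but each `j` is integrated separately, so translation invariance
  -- removes it.
  have ht : ∀ j : separated P, ∫⁻ x, ‖localized P Φ Φ₃ f ℓ j (x + shift P m ℓ j)‖ₑ ^ q ℓ =
      ∫⁻ x, ‖localized P Φ Φ₃ f ℓ j x‖ₑ ^ q ℓ := fun j =>
    lintegral_add_right_eq_self (fun x => ‖localized P Φ Φ₃ f ℓ j x‖ₑ ^ q ℓ) _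
  simp only [ht]
  rw [eLpNorm_ofReal_eq (hq0 ℓ), ← ENNReal.mul_rpow_of_nonneg _ _ (one_div_pos.2 (hq0 ℓ)).le]
  exact ENNReal.rpow_le_rpow (tsum_lintegral_localized_rpow_le hΦ h₃ f ℓ (hq ℓ) (hf ℓ))
    (one_div_pos.2 (hq0 ℓ)).le

end Paraproduct

theorem mainTheorem4
    (p₁ p₂ r r' : ℝ) (hp₁ : 2 < p₁) (hp₂ : 2 < p₂) (hr₁ : 1 < r) (hr₂ : r < 2)
    (hpr : 1 / p₁ + 1 / p₂ = 1 / r) (hr' : 1 / r + 1 / r' = 1)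
    (Φ : 𝓢(ℝ, ℂ)) (hΦ : tsupport (𝓕 (Φ : ℝ → ℂ)) ⊆ Set.Icc (1 / 2) 2)
    (ψ : 𝓢(ℝ, ℝ)) (hψ : Paraproduct.IsCutoff ψ)
    (K : ℕ → ℝ) (A : ℝ) :
    ∃ C : ℝ, ∀ (P : Paraproduct.Params) (Φ₃ : ℤ → 𝓢(ℝ, ℂ)) (k : Fin 3 → ℤ → ℤ),
      Paraproduct.IsThirdFamily K P Φ₃ → Paraproduct.IsScale A P k →
      ∀ (γ : ℤ), 0 ≤ γ → γ < 2 ^ 100 →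
      ∀ (S : Set (ℤ × ℤ)), (∀ s ∈ S, s.1 ≡ γ [ZMOD 2 ^ 100]) →
      ∀ (m : ℕ) (f₁ f₂ f₃ : ℝ → ℂ),
        MemLp f₁ (ENNReal.ofReal p₁) volume → MemLp f₂ (ENNReal.ofReal p₂) volume →
        MemLp f₃ (ENNReal.ofReal r') volume →
        (∀ (ℓ : Fin 3) (j : ℤ) (x : ℝ),
          Summable fun n : {n : ℤ // (j, n) ∈ Paraproduct.goodPart P S} =>
            Paraproduct.piece P Φ Φ₃ ψ k m ![f₁, f₂, f₃] ℓ j n x) ∧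
        (∀ᵐ x : ℝ, Summable fun j : ℤ =>
          Paraproduct.term P Φ Φ₃ ψ k m (Paraproduct.goodPart P S) ![f₁, f₂, f₃] j x) ∧
        Integrable (fun x : ℝ => ∑' j : ℤ,
          Paraproduct.term P Φ Φ₃ ψ k m (Paraproduct.goodPart P S) ![f₁, f₂, f₃] j x) volume ∧
        ‖Paraproduct.form P Φ Φ₃ ψ k m (Paraproduct.goodPart P S) ![f₁, f₂, f₃]‖ ≤
          C * (eLpNorm f₁ (ENNReal.ofReal p₁) volume).toReal *
            (eLpNorm f₂ (ENNReal.ofReal p₂) volume).toReal *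
            (eLpNorm f₃ (ENNReal.ofReal r') volume).toReal := by
  have hr0 : 0 < r := by linarith
  -- The condition `r < 2` puts the dual exponent in the range `p > 2` of the interpolation
  -- estimate.
  have hr'2 : 2 < r' := by
    have h1 : 1 / r < 1 := (div_lt_one hr0).2 hr₁
    have h2 : 1 / 2 < 1 / r := one_div_lt_one_div_of_lt hr0 hr₂
    have h3 : 0 < 1 / r' := by linarith
    have h4 : 0 < r' := one_div_pos.1 h3
    exact (one_div_lt_one_div h4 two_pos).1 (by linarith)
  set q : Fin 3 → ℝ := ![p₁, p₂, r'] with hq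
  have hq2 : ∀ ℓ, 2 < q ℓ := by
    intro ℓ
    fin_cases ℓ
    exacts [hp₁, hp₂, hr'2]
  have hsum : ∑ ℓ, 1 / q ℓ = 1 := by
    rw [Fin.sum_univ_three]
    change 1 / p₁ + 1 / p₂ + 1 / r' = 1
    rw [hpr, hr']
  refine ⟨∏ ℓ, (Paraproduct.localizedConst Φ K (q ℓ) ^ (1 / q ℓ)).toReal,
    fun P Φ₃ k h₃ _ γ _ _ S _ m f₁ f₂ f₃ hf₁ hf₂ hf₃ => ?_⟩
  have hf : ∀ ℓ, MemLp (![f₁, f₂, f₃] ℓ) (ENNReal.ofReal (q ℓ)) := by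
    intro ℓ
    fin_cases ℓ
    exacts [hf₁, hf₂, hf₃]
  have hfin : ∏ ℓ, Paraproduct.localizedConst Φ K (q ℓ) ^ (1 / q ℓ) *
      eLpNorm (![f₁, f₂, f₃] ℓ) (ENNReal.ofReal (q ℓ)) volume ≠ ⊤ :=
    ENNReal.prod_ne_top fun ℓ _ => ENNReal.mul_ne_top
      (ENNReal.rpow_ne_top_of_nonneg (one_div_nonneg.2 (by linarith [hq2 ℓ]))
        (Paraproduct.localizedConst_ne_top Φ K (hq2 ℓ))) (hf ℓ).eLpNorm_ne_top
  obtain ⟨h1, h2, h3⟩ := Paraproduct.integrable_tsum_of_tsum_lintegral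
    (fun j => Paraproduct.aestronglyMeasurable_term (fun ℓ => (hf ℓ).1) _ j) hfin
    (Paraproduct.tsum_lintegral_term_le hq2 hsum hΦ h₃ hψ k m S hf)
  refine ⟨fun ℓ j x => Paraproduct.summable_piece hψ ℓ j _ x, h1, h2, h3.trans_eq ?_⟩
  rw [ENNReal.toReal_prod]
  simp only [ENNReal.toReal_mul, Finset.prod_mul_distrib]
  rw [Fin.prod_univ_three (fun ℓ => (eLpNorm (![f₁, f₂, f₃] ℓ) (ENNReal.ofReal (q ℓ)) volume).toReal),
    mul_assoc, mul_assoc, mul_assoc]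
  rfl
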